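/- Let $G$ be a bicyclic graph, that is, a finite connected simple graph with $|E(G)| = |V(G)| + 1$, and let $L(G) = D(G) - A(G)$ be its Laplacian matrix, where $D(G)$ is the diagonal matrix of vertex degrees and $A(G)$ is the adjacency matrix. If $\mu > 1$ is an integer that is an eigenvalue of $L(G)$, then the multiplicity $m_G(\mu)$ of $\mu$ as an eigenvalue of $L(G)$ satisfies $m_G(\mu) \le 3$. -/

import Mathlib

/-- A graph is bicyclic if it is connected and has exactly one more edge than vertices. -/
structure SimpleGraph.IsBicyclic {V : Type*} (G : SimpleGraph V) : Prop where
  connected : G.Connected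
  card_edgeSet : Nat.card G.edgeSet = Nat.card V + 1

/-- The multiplicity of `μ` as an eigenvalue of the Laplacian matrix `L(G) = D(G) - A(G)`, that is,
the multiplicity of `μ` as a root of the Laplacian characteristic polynomial `det (x I - L(G))`
(it is `0` if `μ` is not an eigenvalue). -/
noncomputable def SimpleGraph.lapMultiplicity {V : Type*} [Fintype V] [DecidableEq V]
    (G : SimpleGraph V) [DecidableRel G.Adj] (μ : ℝ) : ℕ :=
  (G.lapMatrix ℝ).charpoly.rootMultiplicity μ

open Finset Matrix

namespace SimpleGraph

variable {V R : Type*} [Fintype V] [DecidableEq V] (G : SimpleGraph V) [DecidableRel G.Adj]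

/-! A spanning tree `T` omits two edges of `G`. In an eigenspace of dimension at least 4, three
linear conditions leave some `x ≠ 0`: equal ends on each omitted edge, and `x v = 0`. Then `x` is
also a `μ`-eigenvector of `T`, vanishing at `v`. This is impossible: the system grounded at `v` has
an integer determinant, which would be 0. Modulo a prime `p ∣ μ` the term `μ x` disappears, yet the
grounded Laplacian of a tree is injective over `ZMod p`. -/

theorem lapMatrix_mulVec_apply_eq_sum_ite [CommRing R] (x : V → R) (i : V) :
    (G.lapMatrix R *ᵥ x) i = ∑ j, if G.Adj i j then x i - x j else 0 := by
  rw [lapMatrix_mulVec_apply, ← Finset.sum_filter, Finset.sum_sub_distrib, Finset.sum_const,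
    nsmul_eq_mul, ← neighborFinset_eq_filter, card_neighborFinset_eq_degree]

/-- Summing the Laplacian over a vertex set leaves only the contributions of its edge boundary. -/
theorem sum_lapMatrix_mulVec [CommRing R] (x : V → R) (S : Finset V) :
    ∑ i ∈ S, (G.lapMatrix R *ᵥ x) i =
      ∑ i ∈ S, ∑ j ∈ Sᶜ, if G.Adj i j then x i - x j else 0 := by
  have h : ∑ i ∈ S, ∑ j ∈ S, (if G.Adj i j then x i - x j else 0) = 0 := by
    have h' : ∀ i j, (if G.Adj i j then x i - x j else 0) =
        (if G.Adj i j then x i else 0) - (if G.Adj i j then x j else 0) := by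
      intro i j
      split_ifs <;> simp
    simp_rw [h', Finset.sum_sub_distrib]
    rw [sub_eq_zero, Finset.sum_comm]
    simp_rw [G.adj_comm]
  simp_rw [lapMatrix_mulVec_apply_eq_sum_ite, ← Finset.sum_add_sum_compl S]
  rw [Finset.sum_add_distrib, h, zero_add]

variable {G}

/-- Sum `L x = 0` over the side of `a` once the bridge is deleted: only the bridge crosses the cut,
leaving `x a - x b = 0`. -/
theorem IsBridge.eq_of_lapMatrix_mulVec_eq_zero [CommRing R] {x : V → R} {a b : V}
    (hb : G.IsBridge s(a, b)) (hab : G.Adj a b) (hx : G.lapMatrix R *ᵥ x = 0) : x a = x b := by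
  classical
  rw [isBridge_iff] at hb
  let S : Finset V := {i | (G.deleteEdges {s(a, b)}).Reachable a i}
  have haS : a ∈ S := by simp [S]
  have hbS : b ∈ Sᶜ := by simpa [S] using hb
  have hcut : ∀ i ∈ S, ∀ j ∈ Sᶜ, G.Adj i j → i = a ∧ j = b := by
    intro i hi j hj hij
    have hi' : (G.deleteEdges {s(a, b)}).Reachable a i := by simpa [S] using hi
    have hj' : ¬ (G.deleteEdges {s(a, b)}).Reachable a j := by simpa [S] using hj
    by_contra hne
    by_cases he : s(i, j) = s(a, b)
    · rcases Sym2.eq_iff.mp he with h | ⟨rfl, rfl⟩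
      · exact hne h
      · exact hb hi'
    · exact hj' (hi'.trans (Adj.reachable (by simpa [deleteEdges_adj, hij] using he)))
  have hsum := G.sum_lapMatrix_mulVec x S
  simp only [hx, Pi.zero_apply, Finset.sum_const_zero] at hsum
  rw [Finset.sum_eq_single_of_mem a haS fun i hi hia => Finset.sum_eq_zero fun j hj =>
      if_neg fun h => hia (hcut i hi j hj h).1,
    Finset.sum_eq_single_of_mem b hbS fun j hj hjb => if_neg fun h => hjb (hcut a haS j hj h).2,
    if_pos hab] at hsum
  exact sub_eq_zero.mp hsum.symm

/-- The Laplacian of a tree grounded at a vertex has trivial kernel over every commutative ring. -/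
theorem IsTree.eq_zero_of_grounded_lapMatrix_mulVec [CommRing R] (hG : G.IsTree) {x : V → R} {v : V}
    (hv : x v = 0) (hx : ∀ i ≠ v, (G.lapMatrix R *ᵥ x) i = 0) : x = 0 := by
  -- The equation at `v` is free, since the entries of `L x` sum to 0.
  have hx0 : G.lapMatrix R *ᵥ x = 0 := by
    have hsum := G.sum_lapMatrix_mulVec x univ
    rw [Finset.sum_eq_single_of_mem v (mem_univ v) fun i _ hi => hx i hi] at hsum
    ext i
    by_cases hi : i = v
    · simpa [hi] using hsum
    · exact hx i hi
  have hadj : ∀ a b, G.Adj a b → x a = x b := fun a b hab =>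
    (isAcyclic_iff_forall_adj_isBridge.mp hG.isAcyclic hab).eq_of_lapMatrix_mulVec_eq_zero hab hx0
  ext i
  obtain ⟨p⟩ := hG.connected.preconnected i v
  rw [Pi.zero_apply, ← hv]
  clear hv hx
  induction p with
  | nil => rfl
  | cons h _ ih => exact (hadj _ _ h).trans ih

/-- The matrix of the equations `x v = 0` and `(L x) i = c * x i` for `i ≠ v`. -/
def groundedLapMatrix [CommRing R] (G : SimpleGraph V) [DecidableRel G.Adj] (v : V) (c : R) :
    Matrix V V R :=
  (G.lapMatrix R - diagonal fun _ => c).updateRow v (Pi.single v 1)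

theorem groundedLapMatrix_mulVec_eq_zero_iff [CommRing R] {v : V} {c : R} {x : V → R} :
    G.groundedLapMatrix v c *ᵥ x = 0 ↔
      x v = 0 ∧ ∀ i ≠ v, (G.lapMatrix R *ᵥ x) i = c * x i := by
  have hrow : ∀ i, (G.groundedLapMatrix v c *ᵥ x) i =
      if i = v then x v else (G.lapMatrix R *ᵥ x) i - c * x i := by
    intro i
    split_ifs with hi
    · subst hi
      simp [groundedLapMatrix, mulVec]
    · have : (G.groundedLapMatrix v c *ᵥ x) i =
          ((G.lapMatrix R - diagonal fun _ => c) *ᵥ x) i := by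
        simp [groundedLapMatrix, mulVec, updateRow_ne hi]
      rw [this, sub_mulVec, Pi.sub_apply, mulVec_diagonal]
  rw [funext_iff]
  simp_rw [hrow, Pi.zero_apply]
  refine ⟨fun h => ⟨by simpa using h v, fun i hi => ?_⟩, fun h i => ?_⟩
  · simpa [hi, sub_eq_zero] using h i
  · split_ifs with hi
    · exact h.1
    · exact sub_eq_zero.mpr (h.2 i hi)

/-- One integer determinant links the systems over `ℝ` and `ZMod p`. -/
theorem intCast_det_groundedLapMatrix [CommRing R] (v : V) (c : ℤ) :
    ((G.groundedLapMatrix v c).det : R) = (G.groundedLapMatrix v (c : R)).det := by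
  refine (RingHom.map_det (Int.castRingHom R) _).trans ?_
  congr 1
  ext i j
  by_cases hi : i = v
  · subst hi
    by_cases hj : j = i <;> simp [groundedLapMatrix, hj]
  · rw [groundedLapMatrix, groundedLapMatrix, RingHom.mapMatrix_apply, map_apply, updateRow_ne hi,
      updateRow_ne hi]
    simp only [lapMatrix, degMatrix, Matrix.sub_apply, diagonal_apply, adjMatrix_apply, map_sub]
    split_ifs <;> simp

/-- An eigenvector of the Laplacian of a tree for an integer eigenvalue greater than `1` has no
zero entry. -/
theorem IsTree.eq_zero_of_lapMatrix_mulVec_eq_smul (hG : G.IsTree) {μ : ℤ} (hμ : 1 < μ)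
    {x : V → ℝ} (hx : G.lapMatrix ℝ *ᵥ x = (μ : ℝ) • x) {v : V} (hv : x v = 0) : x = 0 := by
  by_contra hx0
  have hdet : (G.groundedLapMatrix v (μ : ℝ)).det = 0 :=
    exists_mulVec_eq_zero_iff.mp ⟨x, hx0, groundedLapMatrix_mulVec_eq_zero_iff.mpr
      ⟨hv, fun i _ => by simp [hx]⟩⟩
  rw [← intCast_det_groundedLapMatrix, Int.cast_eq_zero] at hdet
  obtain ⟨p, hp, hpμ⟩ := Nat.exists_prime_and_dvd (n := μ.natAbs) (by omega)
  have := Fact.mk hp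
  have hcast : (μ : ZMod p) = 0 :=
    (ZMod.intCast_zmod_eq_zero_iff_dvd μ p).mpr (Int.natCast_dvd.mpr hpμ)
  have hdetp : (G.groundedLapMatrix v (0 : ZMod p)).det = 0 := by
    simpa [hdet, hcast] using (intCast_det_groundedLapMatrix (G := G) (R := ZMod p) v μ).symm
  obtain ⟨y, hy0, hy⟩ := exists_mulVec_eq_zero_iff.mpr hdetp
  obtain ⟨hyv, hy⟩ := groundedLapMatrix_mulVec_eq_zero_iff.mp hy
  exact hy0 (hG.eq_zero_of_grounded_lapMatrix_mulVec hyv fun i hi => by simpa using hy i hi)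

/-- An edge enters `L x` only through the difference of its end values. -/
theorem lapMatrix_mulVec_eq_of_le [CommRing R] {H : SimpleGraph V} [DecidableRel H.Adj]
    (hle : H ≤ G) {x : V → R} (hx : ∀ i j, G.Adj i j → ¬ H.Adj i j → x i = x j) :
    H.lapMatrix R *ᵥ x = G.lapMatrix R *ᵥ x := by
  ext i
  simp_rw [lapMatrix_mulVec_apply_eq_sum_ite]
  refine Finset.sum_congr rfl fun j _ => ?_
  by_cases hH : H.Adj i j
  · rw [if_pos hH, if_pos (hle hH)]
  · by_cases hGij : G.Adj i j
    · rw [if_neg hH, if_pos hGij, hx i j hGij hH, sub_self]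
    · rw [if_neg hH, if_neg hGij]

end SimpleGraph

theorem SimpleGraph.IsBicyclic.exists_isTree_le_ncard_edgeSet_diff {V : Type*} [Finite V]
    {G : SimpleGraph V} (hG : G.IsBicyclic) :
    ∃ T ≤ G, T.IsTree ∧ (G.edgeSet \ T.edgeSet).ncard = 2 := by
  classical
  have := Fintype.ofFinite V
  obtain ⟨T, hle, hT⟩ := hG.connected.exists_isTree_le
  refine ⟨T, hle, hT, ?_⟩
  have hcard := hT.card_edgeFinset
  have hG' := hG.card_edgeSet
  rw [Set.ncard_sdiff (edgeSet_mono hle)]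
  rw [← Set.ncard_coe_finset, coe_edgeFinset, ← Nat.card_eq_fintype_card] at hcard
  rw [Nat.card_coe_set_eq] at hG'
  omega

theorem Matrix.IsHermitian.rootMultiplicity_charpoly_le_finrank_eigenspace {n : Type*} [Fintype n]
    [DecidableEq n] {A : Matrix n n ℝ} (hA : A.IsHermitian) (c : ℝ) :
    A.charpoly.rootMultiplicity c ≤ Module.finrank ℝ (Module.End.eigenspace (toLin' A) c) := by
  classical
  have hcard : A.charpoly.rootMultiplicity c = Fintype.card {i // hA.eigenvalues i = c} := by
    rw [← Polynomial.count_roots, hA.roots_charpoly_eq_eigenvalues, Multiset.count_map,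
      Fintype.card_subtype]
    simp [Finset.card_def, eq_comm]
  rw [hcard]
  let w : {i // hA.eigenvalues i = c} → Module.End.eigenspace (toLin' A) c := fun i =>
    ⟨⇑(hA.eigenvectorBasis i), by
      rw [Module.End.mem_eigenspace_iff, toLin'_apply, hA.mulVec_eigenvectorBasis, i.2]⟩
  refine LinearIndependent.fintype_card_le_finrank (b := w) ?_
  apply LinearIndependent.of_comp (Submodule.subtype _)
  have h := hA.eigenvectorBasis.toBasis.linearIndependent.map'
    (WithLp.linearEquiv 2 ℝ (n → ℝ)).toLinearMap (LinearEquiv.ker _)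
  have h' := h.comp (fun i : {i // hA.eigenvalues i = c} => i.1) Subtype.val_injective
  have hw : (Submodule.subtype _ ∘ w) =
      (((WithLp.linearEquiv 2 ℝ (n → ℝ)).toLinearMap ∘ hA.eigenvectorBasis.toBasis) ∘
        fun i : {i // hA.eigenvalues i = c} => i.1) := by
    ext i j
    simp [w]
  rw [hw]
  exact h'

theorem mainTheorem5 {V : Type*} [Fintype V] [DecidableEq V] (G : SimpleGraph V)
    [DecidableRel G.Adj] (hG : G.IsBicyclic) (μ : ℤ) (hμ : 1 < μ)
    (hev : Module.End.HasEigenvalue (Matrix.toLin' (G.lapMatrix ℝ)) (μ : ℝ)) :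
    G.lapMultiplicity (μ : ℝ) ≤ 3 := by
  classical
  obtain ⟨T, hle, hT, hcard⟩ := hG.exists_isTree_le_ncard_edgeSet_diff
  obtain ⟨v⟩ := hG.connected.nonempty
  refine ((G.isHermitian_lapMatrix ℝ).rootMultiplicity_charpoly_le_finrank_eigenspace _).trans ?_
  by_contra! hlt
  let E := Module.End.eigenspace (toLin' (G.lapMatrix ℝ)) (μ : ℝ)
  let D : Set (Sym2 V) := G.edgeSet \ T.edgeSet
  -- `out` orients each omitted edge arbitrarily; the kernel does not depend on the choice.
  let Φ : (V → ℝ) →ₗ[ℝ] (D → ℝ) × ℝ :=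
    (LinearMap.pi fun e : D =>
      (LinearMap.proj e.1.out.1 : (V → ℝ) →ₗ[ℝ] ℝ) - LinearMap.proj e.1.out.2).prod
      (LinearMap.proj v)
  have hfin : Module.finrank ℝ ((D → ℝ) × ℝ) = 3 := by
    rw [Module.finrank_prod, Module.finrank_fintype_fun_eq_card, Module.finrank_self,
      ← Nat.card_eq_fintype_card, Nat.card_coe_set_eq, hcard]
  obtain ⟨⟨x, hxE⟩, hxΦ, hx0⟩ := (Submodule.ne_bot_iff _).mp
    ((Φ.comp E.subtype).ker_ne_bot_of_finrank_lt (by rw [hfin]; exact hlt))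
  have hΦ : Φ x = 0 := hxΦ
  have hxv : x v = 0 := congrArg Prod.snd hΦ
  have hedge : ∀ i j, G.Adj i j → ¬ T.Adj i j → x i = x j := by
    intro i j hij hTij
    have h : x (s(i, j)).out.1 - x (s(i, j)).out.2 = 0 :=
      congrFun (congrArg Prod.fst hΦ) ⟨s(i, j), hij, hTij⟩
    have hout : s((s(i, j)).out.1, (s(i, j)).out.2) = s(i, j) := Quot.out_eq _
    rcases Sym2.eq_iff.mp hout with ⟨h1, h2⟩ | ⟨h1, h2⟩
    · rw [h1, h2] at h
      exact sub_eq_zero.mp h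
    · rw [h1, h2] at h
      exact (sub_eq_zero.mp h).symm
  have hxG : G.lapMatrix ℝ *ᵥ x = (μ : ℝ) • x := by
    rw [← toLin'_apply]
    exact Module.End.mem_eigenspace_iff.mp hxE
  have hxT : T.lapMatrix ℝ *ᵥ x = (μ : ℝ) • x :=
    (SimpleGraph.lapMatrix_mulVec_eq_of_le hle hedge).trans hxG
  exact hx0 (Subtype.ext (hT.eq_zero_of_lapMatrix_mulVec_eq_smul hμ hxT hxv))
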